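/- Let $K$ be a CM-field with maximal totally real subfield $K_0$, $[K_0:\mathbb Q]=N$. Let $K^c$ and $K_0^c$ be the Galois closures of $K$ and $K_0$ over $\mathbb Q$, regarded as subfields of $\mathbb C$, let $G=\mathrm{Gal}(K^c/\mathbb Q)$, and let $\iota\in G$ be complex conjugation, also written $\bar{\ }$. A CM-type of $K$ is a set $\Phi$ of embeddings $K\hookrightarrow\mathbb C$ (all of which have image in $K^c$) such that $\Phi\cap\iota\Phi=\emptyset$ and $\Phi\cup\iota\Phi$ is the set of all embeddings. Two CM-types $\Phi,\Phi'$ are conjugate if $\Phi'=\tau\Phi$ for some $\tau\in G$. The reflex field $K^*(\Phi)$ is the subfield of $K^c$ fixed by $H^*(\Phi)=\{\sigma\in G:\sigma\Phi=\Phi\}$. Let $\Lambda$ be a system of representatives for the conjugacy classes of CM-types of $K$, and let $Q_\Lambda$ be the quadratic form over $\mathbb Q$ on $\bigoplus_{\Phi\in\Lambda}K^*(\Phi)$ that is the orthogonal sum of the forms $a\mapsto \mathrm{Tr}_{K^*(\Phi)/\mathbb Q}(\bar a a)$; denote by $K_0^c\otimes_{\mathbb Q}Q_\Lambda$ its extension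 of scalars to $K_0^c$. Let $d\in K_0$ be totally positive with $K=K_0(\sqrt{-d})$, let $\varphi_1,\dots,\varphi_N$ be the embeddings $K_0\hookrightarrow\mathbb C$ (all with image in $K_0^c$), and let $$V=K_0^c(\sqrt{-\varphi_1(d)})\otimes_{K_0^c}\cdots\otimes_{K_0^c}K_0^c(\sqrt{-\varphi_N(d)}),\qquad q=\langle 1,\varphi_1(d)\rangle\otimes\cdots\otimes\langle 1,\varphi_N(d)\rangle,$$ where $\langle 1,a\rangle$ is the quadratic form $x^2+ay^2$, and $q$ is regarded as a quadratic form over $K_0^c$ on $V$ by letting $\langle 1,\varphi_i(d)\rangle$ be the form $x+y\sqrt{-\varphi_i(d)}\mapsto x^2+\varphi_i(d)y^2$ on $K_0^c(\sqrt{-\varphi_i(d)})$. Then there is an isomorphism of $K_0^c$-algebras $$\phi_\Lambda:K_0^c\otimes_{\mathbb Q}\Bigl(\bigoplus_{\Phi\in\Lambda}K^*(\Phi)\Bigr)\xrightarrow{\ \cong\ }V,$$ and every such isomorphism satisfies $q(\phi_\Lambda(w))=2^{-N}\,(K_0^c\otimes_{\mathbb Q}Q_\Lambda)(w)$ for all $w$.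 -/

import Mathlib

open NumberField
open scoped TensorProduct Pointwise ComplexConjugate

noncomputable section

namespace ReflexPfister

/-! ### Galois closures, embeddings and complex conjugation -/

section GaloisClosure

variable (K : Type*) [Field K] [NumberField K]

/-- The Galois closure over `ℚ` of a number field `K`, as a subfield of `ℂ`: the compositum of the
images of all the embeddings `K → ℂ`. -/
abbrev GaloisClosure : IntermediateField ℚ ℂ := IntermediateField.normalClosure ℚ K ℂ

instance : FiniteDimensional ℚ (GaloisClosure K) :=
  normalClosure.is_finiteDimensional ℚ K ℂ

instance : Normal ℚ (GaloisClosure K) :=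
  Algebra.IsAlgebraic.isNormalClosure_normalClosure
    (fun _ => IsAlgClosed.splits _) |>.normal

/-- The embeddings of `K` into `ℂ`. Each of them takes its values in the Galois closure of `K` in
`ℂ` and is recorded with that target; see `embEquiv`. -/
abbrev Emb : Type _ := K →ₐ[ℚ] GaloisClosure K

/-- Embeddings of `K` into its Galois closure in `ℂ` are the same as embeddings of `K` into `ℂ`. -/
def embEquiv : Emb K ≃ (K →ₐ[ℚ] ℂ) where
  toFun φ := (GaloisClosure K).val.comp φ
  invFun φ := φ.codRestrict (GaloisClosure K).toSubalgebra
    fun x => φ.fieldRange_le_normalClosure ⟨x, rfl⟩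
  left_inv _ := rfl
  right_inv _ := rfl

/-- The Galois group `G` of the Galois closure of `K` over `ℚ`. -/
abbrev GalGroup : Type _ := GaloisClosure K ≃ₐ[ℚ] GaloisClosure K

/-- `G` acts on the embeddings of `K` by composition. -/
instance : MulAction (GalGroup K) (Emb K) where
  smul σ φ := (σ : GaloisClosure K →ₐ[ℚ] GaloisClosure K).comp φ
  one_smul _ := rfl
  mul_smul _ _ _ := rfl

variable {K} in
lemma smul_emb_apply (σ : GalGroup K) (φ : Emb K) (x : K) : (σ • φ) x = σ (φ x) := rfl

/-- Complex conjugation `ι`, as an element of `G`. -/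
def iota : GalGroup K := (Complex.conjAe.restrictScalars ℚ).restrictNormal (GaloisClosure K)

lemma coe_iota (x : GaloisClosure K) : ((iota K x : GaloisClosure K) : ℂ) = conj (x : ℂ) :=
  AlgEquiv.restrictNormal_commutes (Complex.conjAe.restrictScalars ℚ) (GaloisClosure K) x

lemma iota_iota (x : GaloisClosure K) : iota K (iota K x) = x := by
  apply Subtype.ext
  rw [coe_iota, coe_iota, Complex.conj_conj]

end GaloisClosure

/-! ### CM-types and reflex fields -/

section CMTypes

variable (K : Type*) [Field K] [NumberField K]

/-- A CM-type of `K`: a set `Φ` of embeddings such that `Φ` and `ιΦ` are disjoint and every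
embedding belongs to `Φ ∪ ιΦ`. -/
@[ext] structure CMType where
  /-- the set of embeddings -/
  emb : Set (Emb K)
  disjoint_iota : Disjoint emb (iota K • emb)
  union_iota : emb ∪ iota K • emb = Set.univ

variable {K}

/-- Two CM-types are conjugate when `Φ' = τΦ` for some `τ ∈ G`. -/
def CMType.IsConj (Φ Φ' : CMType K) : Prop := ∃ τ : GalGroup K, Φ'.emb = τ • Φ.emb

/-- `Λ` is a system of representatives for the conjugacy classes of the CM-types of `K`. -/
def IsRepresentatives (Λ : Set (CMType K)) : Prop := ∀ Φ : CMType K, ∃! Ψ, Ψ ∈ Λ ∧ Φ.IsConj Ψ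

/-- The subgroup `H*(Φ)` of all `σ ∈ G` with `σΦ = Φ`; see `mem_reflexGroup_iff` for the
description through the set of all the automorphisms whose restriction to `K` is in `Φ`. -/
def reflexGroup (Φ : CMType K) : Subgroup (GalGroup K) := MulAction.stabilizer (GalGroup K) Φ.emb

/-- The set `S_Φ ⊆ G` of the automorphisms that restrict to a member of `Φ` on `K`, where `K` is
regarded as a subfield of its Galois closure through `j`. -/
def typeLift (j : Emb K) (Φ : CMType K) : Set (GalGroup K) := {σ | σ • j ∈ Φ.emb}

lemma exists_smul_eq (φ ψ : Emb K) : ∃ σ : GalGroup K, σ • φ = ψ := by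
  let e : φ.range ≃ₐ[ℚ] ψ.range :=
    (AlgEquiv.ofInjectiveField φ).symm.trans (AlgEquiv.ofInjectiveField ψ)
  let e' : φ.fieldRange ≃ₐ[ℚ] ψ.fieldRange := e
  refine ⟨e'.liftNormal (GaloisClosure K), AlgHom.ext fun x => ?_⟩
  have h := e'.liftNormal_commutes (GaloisClosure K) ⟨φ x, x, rfl⟩
  refine Eq.trans h ?_
  have h2 : (AlgEquiv.ofInjectiveField φ).symm ⟨φ x, x, rfl⟩ = x :=
    (AlgEquiv.ofInjectiveField φ).symm_apply_apply x
  change ((AlgEquiv.ofInjectiveField ψ ((AlgEquiv.ofInjectiveField φ).symm ⟨φ x, x, rfl⟩) :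
    ψ.range) : GaloisClosure K) = ψ x
  rw [h2]
  rfl

lemma mem_reflexGroup_iff (j : Emb K) (Φ : CMType K) (σ : GalGroup K) :
    σ ∈ reflexGroup Φ ↔ σ • typeLift j Φ = typeLift j Φ := by
  rw [reflexGroup, MulAction.mem_stabilizer_iff]
  constructor
  · intro h
    ext τ
    rw [Set.mem_smul_set_iff_inv_smul_mem, smul_eq_mul]
    change (σ⁻¹ * τ) • j ∈ Φ.emb ↔ τ • j ∈ Φ.emb
    conv_rhs => rw [← h, Set.mem_smul_set_iff_inv_smul_mem]
    rw [mul_smul]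
  · intro h
    ext ψ
    obtain ⟨τ, rfl⟩ := exists_smul_eq j ψ
    have h' := Set.ext_iff.mp h τ
    rw [Set.mem_smul_set_iff_inv_smul_mem, smul_eq_mul] at h'
    change (σ⁻¹ * τ) • j ∈ Φ.emb ↔ τ • j ∈ Φ.emb at h'
    rw [Set.mem_smul_set_iff_inv_smul_mem, ← mul_smul]
    exact h'

/-- The reflex field `K*(Φ)`: the subfield of the Galois closure fixed by `H*(Φ)`. -/
def reflexField (Φ : CMType K) : IntermediateField ℚ (GaloisClosure K) :=
  IntermediateField.fixedField (reflexGroup Φ)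

/-- For a CM-field `K`, the automorphisms `ισι` and `σ` agree on the images of `K`. -/
lemma iota_mul_mul_iota_smul [IsCMField K] (σ : GalGroup K) (φ : Emb K) :
    (iota K * σ * iota K) • φ = σ • φ := by
  have key : ∀ (ψ : Emb K) (x : K), iota K (ψ x) = ψ (IsCMField.complexConj K x) := by
    intro ψ x
    apply Subtype.ext
    rw [coe_iota]
    exact (IsCMField.complexEmbedding_complexConj K ((GaloisClosure K).val.comp ψ : K →+* ℂ) x).symm
  ext x
  have h1 : iota K (φ x) = φ (IsCMField.complexConj K x) := key φ x
  have h2 := key (σ • φ) (IsCMField.complexConj K x)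
  rw [IsCMField.complexConj_apply_apply] at h2
  congr 1
  calc ((iota K * σ * iota K) • φ) x = iota K (σ (iota K (φ x))) := rfl
    _ = iota K ((σ • φ) (IsCMField.complexConj K x)) := by rw [h1]; rfl
    _ = (σ • φ) x := h2

lemma iota_mem_reflexField [IsCMField K] (Φ : CMType K) (x : GaloisClosure K)
    (hx : x ∈ reflexField Φ) : iota K x ∈ reflexField Φ := by
  rw [reflexField, IntermediateField.mem_fixedField_iff] at hx ⊢
  intro σ hσ
  have hmem : iota K * σ * iota K ∈ reflexGroup Φ := by
    rw [reflexGroup, MulAction.mem_stabilizer_iff] at hσ ⊢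
    refine Eq.trans ?_ hσ
    exact Set.image_congr fun φ _ => iota_mul_mul_iota_smul σ φ
  have h := congrArg (iota K) (hx _ hmem)
  change iota K (iota K (σ (iota K x))) = iota K x at h
  rwa [iota_iota] at h

/-- Complex conjugation on the reflex field of a CM-type of a CM-field. -/
def reflexConj [IsCMField K] (Φ : CMType K) : reflexField Φ →ₐ[ℚ] reflexField Φ :=
  ((iota K : GaloisClosure K →ₐ[ℚ] GaloisClosure K).comp (reflexField Φ).val).codRestrict
    (reflexField Φ).toSubalgebra fun x => iota_mem_reflexField Φ x x.2

instance : Finite (Emb K) := inferInstance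

instance : Finite (CMType K) :=
  Finite.of_injective CMType.emb fun _ _ h => CMType.ext h

/-- The quadratic form `a ↦ Tr_{K*(Φ)/ℚ}(ā a)` on the reflex field. -/
def traceForm [IsCMField K] (Φ : CMType K) : QuadraticForm ℚ (reflexField Φ) :=
  LinearMap.BilinMap.toQuadraticMap
    ((Algebra.traceForm ℚ (reflexField Φ)).comp (reflexConj Φ).toLinearMap LinearMap.id)

lemma traceForm_apply [IsCMField K] (Φ : CMType K) (a : reflexField Φ) :
    traceForm Φ a = Algebra.trace ℚ (reflexField Φ) (reflexConj Φ a * a) := rfl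

/-- The direct sum `⨁_{Φ ∈ Λ} K*(Φ)` of the reflex fields, as a `ℚ`-algebra. -/
abbrev ReflexSum (Λ : Set (CMType K)) : Type _ := ∀ Φ : Λ, reflexField (Φ : CMType K)

/-- `Q_Λ`: the orthogonal sum of the forms `Tr_{K*(Φ)/ℚ}(ā a)`. -/
def reflexForm [IsCMField K] (Λ : Set (CMType K)) : QuadraticForm ℚ (ReflexSum Λ) :=
  letI : Fintype Λ := Fintype.ofFinite Λ
  QuadraticMap.pi fun Φ : Λ => traceForm (Φ : CMType K)

end CMTypes

/-! ### Tensor products of quadratic forms -/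

section TensorProducts

variable {R : Type*} [CommRing R]

/-- The binary form `⟨1, a⟩`, that is `x² + a y²`, on the quadratic `R`-algebra `R(√-a)` with the
basis `1, √-a`. -/
def binaryForm (a : R) : QuadraticForm R (QuadraticAlgebra R (-a) 0) :=
  QuadraticMap.sq.comp (QuadraticAlgebra.reₗ (-a) 0) +
    a • QuadraticMap.sq.comp (QuadraticAlgebra.imₗ (-a) 0)

lemma binaryForm_apply (a : R) (z : QuadraticAlgebra R (-a) 0) :
    binaryForm a z = z.re ^ 2 + a * z.im ^ 2 := by
  simp [binaryForm, pow_two]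

lemma binaryForm_eq_norm (a : R) (z : QuadraticAlgebra R (-a) 0) :
    binaryForm a z = QuadraticAlgebra.norm z := by
  rw [binaryForm_apply, QuadraticAlgebra.norm_def]
  ring

variable {ι : Type*} [Fintype ι] {M : ι → Type*} [∀ i, AddCommGroup (M i)] [∀ i, Module R (M i)]

/-- The tensor product of a finite family of symmetric bilinear forms: on pure tensors it is the
product of the values of the factors. -/
def bilinTensor (B : ∀ i, LinearMap.BilinForm R (M i)) : LinearMap.BilinForm R (⨂[R] i, M i) :=
  (PiTensorProduct.map₂ B).compr₂ (PiTensorProduct.constantBaseRingEquiv ι R).toLinearMap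

lemma bilinTensor_tprod (B : ∀ i, LinearMap.BilinForm R (M i)) (x y : ∀ i, M i) :
    bilinTensor B (PiTensorProduct.tprod R x) (PiTensorProduct.tprod R y) =
      ∏ i, B i (x i) (y i) := by
  simp [bilinTensor, PiTensorProduct.map₂_tprod_tprod]

/-- The tensor product of a finite family of quadratic forms: the quadratic form of the tensor
product of the symmetric bilinear forms `Bᵢ` with `Bᵢ(x, x) = Qᵢ(x)`. -/
def quadTensor [Invertible (2 : R)] (Q : ∀ i, QuadraticForm R (M i)) :
    QuadraticForm R (⨂[R] i, M i) :=
  LinearMap.BilinMap.toQuadraticMap (bilinTensor fun i => QuadraticMap.associated (Q i))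

lemma quadTensor_tprod [Invertible (2 : R)] (Q : ∀ i, QuadraticForm R (M i)) (x : ∀ i, M i) :
    quadTensor Q (PiTensorProduct.tprod R x) = ∏ i, Q i (x i) := by
  rw [quadTensor, LinearMap.BilinMap.toQuadraticMap_apply, bilinTensor_tprod]
  exact Finset.prod_congr rfl fun i _ => QuadraticMap.associated_eq_self_apply R (Q i) (x i)

end TensorProducts

/-! ### The Pfister form -/

section Pfister

variable (K : Type*) [Field K] [NumberField K]

/-- The Galois closure `K₀ᶜ` of the maximal totally real subfield `K₀` of `K`. -/
abbrev RealClosure : IntermediateField ℚ ℂ := GaloisClosure (maximalRealSubfield K)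

variable {K}

/-- `d` is totally positive: positive under every real embedding. -/
def IsTotallyPositive {F : Type*} [Field F] (d : F) : Prop := ∀ φ : F →+* ℝ, 0 < φ d

/-- The algebra `V = ⨂ᵢ K₀ᶜ(√-φᵢ(d))` over `K₀ᶜ`, where `φᵢ` runs through all the embeddings
of `K₀`. -/
abbrev PfisterAlgebra (d : maximalRealSubfield K) : Type _ :=
  ⨂[RealClosure K] φ : Emb (maximalRealSubfield K), QuadraticAlgebra (RealClosure K) (-φ d) 0

/-- The Pfister form `q = ⟨1, φ₁(d)⟩ ⊗ ⋯ ⊗ ⟨1, φ_N(d)⟩` on `V`. -/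
def pfisterForm (d : maximalRealSubfield K) :
    QuadraticForm (RealClosure K) (PfisterAlgebra d) :=
  letI : Fintype (Emb (maximalRealSubfield K)) := Fintype.ofFinite _
  letI : Invertible (2 : RealClosure K) := invertibleOfNonzero two_ne_zero
  quadTensor fun φ : Emb (maximalRealSubfield K) => binaryForm (φ d)

end Pfister

end ReflexPfister

end

open ReflexPfister

/-!
Both algebras are finite products of fields over the totally real field `K₀ᶜ`, and both have the
CM-types of `K` as their points.

* A point of `V = ⨂ K₀ᶜ(√-φ(d))` is a choice of a square root of `-φ(d)` for every embedding `φ` of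
  `K₀`. Since `K = K₀(s)` with `s² = -d`, this is a choice of one of the two extensions of every `φ`
  to `K`, that is, a CM-type (`pfisterPointType_bijective`).
* A point of `K₀ᶜ ⊗ ⨁ K*(Φ)` is an embedding of one of the reflex fields `K*(Φ)`. Such an embedding
  is the restriction of some `τ ∈ G`, it determines the CM-type `τΦ`, and every CM-type is obtained
  exactly once, by the orbit-stabilizer theorem (`reflexPointType_bijective`).

Both bijections respect the action of the Galois group of `Kᶜ` over `K₀ᶜ`, and both algebras have as
many points in `Kᶜ` as their dimension. Such an algebra is recovered from its points as the algebra
of the equivariant functions with values in `Kᶜ` (`mem_range_evalHoms`), so the two are isomorphic.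

For the forms, let `pointForm a b = ∑ f(a) conj(f(b))`, the sum over all the complex points `f` of
an algebra. Every isomorphism permutes the points, so it preserves `pointForm`. On `K₀ᶜ(√-φ(d))`
this is twice the bilinear form of `⟨1, φ(d)⟩`, because `√-φ(d)` is purely imaginary; hence on `V`
it is `2^N q` (`coe_pfisterForm`). On a reflex field it is the trace form `Tr(ā a)`, because complex
conjugation commutes with all the embeddings of `Kᶜ` (`map_iota`); hence on `K₀ᶜ ⊗ ⨁ K*(Φ)` it is
the extension of `Q_Λ` (`coe_baseChange_reflexForm`).
-/

noncomputable section

namespace ReflexPfister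

/-! ### Finite algebras split by a Galois extension -/

section GaloisDescent

variable (F L A : Type*) [Field F] [Field L] [Algebra F L] [CommRing A] [Algebra F A]

/-- The evaluation map from an `F`-algebra `A` to the functions on its `L`-valued points. -/
def evalHoms : A →ₐ[F] ((A →ₐ[F] L) → L) :=
  AlgHom.pi fun f => f

variable {F L A}

@[simp]
lemma evalHoms_apply (a : A) (f : A →ₐ[F] L) : evalHoms F L A a f = f a := rfl

/-- If `A` has as many `L`-valued points as its dimension, the square matrix of the values of the
points on a basis is invertible, because distinct points are linearly independent over `L`. -/
lemma isUnit_pointMatrix [FiniteDimensional F A] [Fintype (A →ₐ[F] L)]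
    [DecidableEq (A →ₐ[F] L)] (b : Module.Basis (A →ₐ[F] L) F A) :
    IsUnit (Matrix.of fun (f : A →ₐ[F] L) j => f (b j)) := by
  rw [← Matrix.linearIndependent_rows_iff_isUnit, Fintype.linearIndependent_iff]
  intro c hc
  have h := Fintype.linearIndependent_iff.mp (linearIndependent_toLinearMap F A L) c
  refine h (b.ext fun j => ?_)
  have := congrFun hc j
  simpa [Matrix.row] using this

lemma exists_basis_points [FiniteDimensional F A]
    (hA : Nat.card (A →ₐ[F] L) = Module.finrank F A) :
    Nonempty (Module.Basis (A →ₐ[F] L) F A) := by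
  have := Fintype.ofFinite (A →ₐ[F] L)
  rw [Nat.card_eq_fintype_card] at hA
  exact ⟨(Module.finBasisOfFinrankEq F A hA.symm).reindex (Fintype.equivFin _).symm⟩

lemma evalHoms_injective [FiniteDimensional F A]
    (hA : Nat.card (A →ₐ[F] L) = Module.finrank F A) :
    Function.Injective (evalHoms F L A) := by
  classical
  have := Fintype.ofFinite (A →ₐ[F] L)
  obtain ⟨b⟩ := exists_basis_points hA
  rw [injective_iff_map_eq_zero]
  intro a ha
  have h0 : (fun j => algebraMap F L (b.repr a j)) = 0 := by
    refine Matrix.mulVec_injective_of_isUnit (isUnit_pointMatrix b) ?_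
    ext f
    have h := congrFun ha f
    rw [evalHoms_apply, ← b.sum_repr a, map_sum] at h
    simpa [Matrix.mulVec, dotProduct, Algebra.smul_def, mul_comm] using h
  rw [← b.sum_repr a]
  refine Finset.sum_eq_zero fun j _ => ?_
  have := congrFun h0 j
  rw [Pi.zero_apply, FaithfulSMul.algebraMap_eq_zero_iff] at this
  rw [this, zero_smul]

/-- The image of the evaluation map consists of the functions that are equivariant under the Galois
group: the coordinates of such a function in a basis of `A` are fixed, hence lie in `F`. -/
lemma mem_range_evalHoms [FiniteDimensional F A] [FiniteDimensional F L] [IsGalois F L]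
    (hA : Nat.card (A →ₐ[F] L) = Module.finrank F A) (g : (A →ₐ[F] L) → L) :
    g ∈ (evalHoms F L A).range ↔
      ∀ (σ : L ≃ₐ[F] L) (f : A →ₐ[F] L), g ((σ : L →ₐ[F] L).comp f) = σ (g f) := by
  classical
  have := Fintype.ofFinite (A →ₐ[F] L)
  constructor
  · rintro ⟨a, rfl⟩ σ f
    rfl
  intro hg
  obtain ⟨b⟩ := exists_basis_points hA
  have hM := isUnit_pointMatrix b
  set M := Matrix.of fun (f : A →ₐ[F] L) j => f (b j) with hMdef
  set c := M⁻¹.mulVec g with hc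
  have hMc : M.mulVec c = g := by
    rw [hc, Matrix.mulVec_mulVec, Matrix.mul_nonsing_inv _ ((Matrix.isUnit_iff_isUnit_det _).mp hM),
      Matrix.one_mulVec]
  have hsum (f : A →ₐ[F] L) : ∑ j, f (b j) * c j = g f := congrFun hMc f
  -- `c` and `σ c` solve the same linear system, because `g` is equivariant.
  have hfix (σ : L ≃ₐ[F] L) : (fun j => σ (c j)) = c := by
    refine Matrix.mulVec_injective_of_isUnit hM ?_
    rw [hMc]
    ext f
    set f' := (σ.symm : L →ₐ[F] L).comp f with hf'
    have hf : f = (σ : L →ₐ[F] L).comp f' := by ext; simp [hf']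
    rw [hf, hg, ← hsum f', map_sum]
    simp [M, Matrix.mulVec, dotProduct]
  have hF (j) : ∃ x : F, algebraMap F L x = c j :=
    (IsGalois.mem_range_algebraMap_iff_fixed (F := F) (c j)).mpr fun σ => congrFun (hfix σ) j
  choose x hx using hF
  refine ⟨∑ j, x j • b j, funext fun f => ?_⟩
  change f (∑ j, x j • b j) = g f
  rw [← hsum f, map_sum]
  refine Finset.sum_congr rfl fun j _ => ?_
  rw [map_smul, Algebra.smul_def, hx, mul_comm]

/-- Two finite `F`-algebras split by a Galois extension `L` of `F` are isomorphic as soon as their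
sets of `L`-valued points are isomorphic as sets with an action of the Galois group. -/
theorem nonempty_algEquiv_of_equivariant {B : Type*} [CommRing B] [Algebra F B]
    [FiniteDimensional F A] [FiniteDimensional F B] [FiniteDimensional F L] [IsGalois F L]
    (hA : Nat.card (A →ₐ[F] L) = Module.finrank F A)
    (hB : Nat.card (B →ₐ[F] L) = Module.finrank F B)
    (e : (A →ₐ[F] L) ≃ (B →ₐ[F] L))
    (he : ∀ (σ : L ≃ₐ[F] L) (f : A →ₐ[F] L),
      e ((σ : L →ₐ[F] L).comp f) = (σ : L →ₐ[F] L).comp (e f)) :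
    Nonempty (A ≃ₐ[F] B) := by
  let ψ : B →ₐ[F] ((A →ₐ[F] L) → L) := AlgHom.pi fun f => e f
  have hψ : Function.Injective ψ := fun x y hxy => evalHoms_injective hB <| funext fun h => by
    obtain ⟨f, rfl⟩ := e.surjective h
    exact congrFun hxy f
  have hrange : (evalHoms F L A).range = ψ.range := by
    ext g
    rw [mem_range_evalHoms hA]
    have h1 : g ∈ ψ.range ↔ g ∘ e.symm ∈ (evalHoms F L B).range := by
      constructor
      · rintro ⟨b, rfl⟩
        refine ⟨b, funext fun h => ?_⟩
        change h b = e (e.symm h) b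
        rw [e.apply_symm_apply]
      · rintro ⟨b, hb⟩
        refine ⟨b, funext fun f => ?_⟩
        have := congrFun hb (e f)
        change e f b = g (e.symm (e f)) at this
        rwa [e.symm_apply_apply] at this
    rw [h1, mem_range_evalHoms hB]
    refine forall_congr' fun σ => ?_
    rw [e.forall_congr_left]
    refine forall_congr' fun h => ?_
    have h2 : (σ : L →ₐ[F] L).comp (e.symm h) = e.symm ((σ : L →ₐ[F] L).comp h) := by
      rw [e.eq_symm_apply, he, e.apply_symm_apply]
    rw [h2]
    rfl
  exact ⟨(AlgEquiv.ofInjective _ (evalHoms_injective hA)).trans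
    ((Subalgebra.equivOfEq _ _ hrange).trans (AlgEquiv.ofInjective ψ hψ).symm)⟩

end GaloisDescent

/-! ### Homomorphisms from finite products, tensor products and quadratic algebras -/

section Points

/-- A homomorphism from a finite product of algebras to a domain factors through one of the
factors: it does not vanish on all of the orthogonal idempotents. -/
lemma exists_eq_comp_evalAlgHom {k ι L : Type*} {R : ι → Type*} [Finite ι] [CommRing k]
    [∀ i, CommRing (R i)] [∀ i, Algebra k (R i)] [CommRing L] [IsDomain L] [Algebra k L]
    (f : (∀ i, R i) →ₐ[k] L) :
    ∃ (i : ι) (g : R i →ₐ[k] L), f = g.comp (Pi.evalAlgHom k R i) := by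
  classical
  have := Fintype.ofFinite ι
  have h1 : ∑ i, f (Pi.single i 1) = 1 := by
    rw [← map_sum, ← map_one f]
    exact congrArg f (Finset.univ_sum_single (1 : ∀ i, R i))
  obtain ⟨i, -, hi⟩ := Finset.exists_ne_zero_of_sum_ne_zero (h1.trans_ne one_ne_zero)
  have hidem : f (Pi.single i 1) * f (Pi.single i 1) = f (Pi.single i 1) := by
    rw [← map_mul, ← Pi.single_mul, one_mul]
  have hone : f (Pi.single i 1) = 1 := mul_right_cancel₀ hi (hidem.trans (one_mul _).symm)
  have hf (x : ∀ i, R i) : f x = f (Pi.single i (x i)) := by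
    have hx : x * Pi.single i 1 = Pi.single i (x i) := by
      rw [← Pi.single_mul_right, mul_one]
    rw [← hx, map_mul, hone, mul_one]
  refine ⟨i, AlgHom.ofLinearMap (f.toLinearMap ∘ₗ LinearMap.single k R i) hone fun x y => ?_,
    AlgHom.ext hf⟩
  change f (Pi.single i (x * y)) = f (Pi.single i x) * f (Pi.single i y)
  rw [Pi.single_mul, map_mul]

/-- The points of a finite product of algebras with values in a domain are the points of its
factors. -/
def sigmaPointsEquiv {k ι L : Type*} {R : ι → Type*} [Finite ι] [CommRing k]
    [∀ i, CommRing (R i)] [∀ i, Algebra k (R i)] [CommRing L] [IsDomain L] [Algebra k L] :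
    (Σ i, R i →ₐ[k] L) ≃ ((∀ i, R i) →ₐ[k] L) :=
  Equiv.ofBijective (fun p => p.2.comp (Pi.evalAlgHom k R p.1)) <| by
    classical
    constructor
    · rintro ⟨i, g⟩ ⟨j, h⟩ hgh
      have happ (x : ∀ i, R i) : g (x i) = h (x j) := DFunLike.congr_fun hgh x
      obtain rfl : i = j := by
        by_contra hij
        have := happ (Pi.single i 1)
        rw [Pi.single_eq_same, Pi.single_eq_of_ne (Ne.symm hij), map_one, map_zero] at this
        exact one_ne_zero this
      congr 1
      ext x
      simpa using happ (Pi.single i x)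
    · intro f
      obtain ⟨i, g, rfl⟩ := exists_eq_comp_evalAlgHom f
      exact ⟨⟨i, g⟩, rfl⟩

/-- The homomorphism from a tensor product of commutative algebras that is the product of a family
of homomorphisms from the factors. -/
def piTensorProdHom {R ι S : Type*} {A : ι → Type*} [Fintype ι] [CommRing R]
    [∀ i, CommRing (A i)] [∀ i, Algebra R (A i)] [CommRing S] [Algebra R S]
    (g : ∀ i, A i →ₐ[R] S) : (⨂[R] i, A i) →ₐ[R] S :=
  PiTensorProduct.liftAlgHom
    ((MultilinearMap.mkPiAlgebra R ι S).compLinearMap fun i => (g i).toLinearMap)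
    (by simp) (by simp [Finset.prod_mul_distrib])

lemma piTensorProdHom_tprod {R ι S : Type*} {A : ι → Type*} [Fintype ι] [CommRing R]
    [∀ i, CommRing (A i)] [∀ i, Algebra R (A i)] [CommRing S] [Algebra R S]
    (g : ∀ i, A i →ₐ[R] S) (x : ∀ i, A i) :
    piTensorProdHom g (PiTensorProduct.tprod R x) = ∏ i, g i (x i) :=
  PiTensorProduct.lift.tprod x

open scoped Classical in
/-- The points of a tensor product of finitely many commutative algebras are the families of
points of the factors. -/
def piTensorPointsEquiv {R ι S : Type*} {A : ι → Type*} [Fintype ι] [CommRing R]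
    [∀ i, CommRing (A i)] [∀ i, Algebra R (A i)] [CommRing S] [Algebra R S] :
    ((⨂[R] i, A i) →ₐ[R] S) ≃ ∀ i, A i →ₐ[R] S where
  toFun f i := f.comp (PiTensorProduct.singleAlgHom i)
  invFun := piTensorProdHom
  left_inv f := by
    refine PiTensorProduct.algHom_ext fun i => AlgHom.ext fun x => ?_
    rw [AlgHom.comp_apply, PiTensorProduct.singleAlgHom_apply, piTensorProdHom_tprod,
      Finset.prod_eq_single i]
    · simp
    · intro j _ hj
      rw [MonoidHom.mulSingle_apply, Pi.mulSingle_eq_of_ne hj, map_one]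
    · simp
  right_inv g := by
    funext i
    ext x
    rw [AlgHom.comp_apply, PiTensorProduct.singleAlgHom_apply, piTensorProdHom_tprod,
      Finset.prod_eq_single i]
    · simp
    · intro j _ hj
      simp [Pi.mulSingle_eq_of_ne hj]
    · simp

lemma piTensorPointsEquiv_symm_tprod {R ι S : Type*} {A : ι → Type*} [Fintype ι] [CommRing R]
    [∀ i, CommRing (A i)] [∀ i, Algebra R (A i)] [CommRing S] [Algebra R S]
    (g : ∀ i, A i →ₐ[R] S) (x : ∀ i, A i) :
    piTensorPointsEquiv.symm g (PiTensorProduct.tprod R x) = ∏ i, g i (x i) :=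
  piTensorProdHom_tprod g x

/-- The points of `R(√a)` with values in a field are the square roots of `a`. -/
def quadPointsEquiv {R S : Type*} [CommRing R] [CommRing S] [Algebra R S] (a : R) :
    (QuadraticAlgebra R a 0 →ₐ[R] S) ≃ {u : S // u ^ 2 = algebraMap R S a} :=
  QuadraticAlgebra.lift.symm.trans <| Equiv.subtypeEquivRight fun u => by
    rw [zero_smul, add_zero, Algebra.algebraMap_eq_smul_one, pow_two]

lemma quadPointsEquiv_symm_apply {R S : Type*} [CommRing R] [CommRing S] [Algebra R S] (a : R)
    (u : {u : S // u ^ 2 = algebraMap R S a}) (z : QuadraticAlgebra R a 0) :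
    (quadPointsEquiv a).symm u z = algebraMap R S z.re + algebraMap R S z.im * u := by
  simp [quadPointsEquiv, Algebra.smul_def]

/-- If `a` has a nonzero square root `z`, its square roots are `z` and `-z`. -/
def sqrtEquivBool {S : Type*} [Field S] [CharZero S] {a : S} (z : S) (hz : z ≠ 0)
    (hza : z ^ 2 = a) : Bool ≃ {u : S // u ^ 2 = a} :=
  Equiv.ofBijective (fun b => ⟨bif b then z else -z, by cases b <;> simp [hza]⟩) <| by
    have hne : z ≠ -z := fun h => hz (self_eq_neg.mp h)
    constructor
    · rintro (_ | _) (_ | _) h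
      · rfl
      · exact (hne (congrArg Subtype.val h).symm).elim
      · exact (hne (congrArg Subtype.val h)).elim
      · rfl
    · rintro ⟨u, hu⟩
      rcases sq_eq_sq_iff_eq_or_eq_neg.mp (hu.trans hza.symm) with h | h
      · exact ⟨true, Subtype.ext h.symm⟩
      · exact ⟨false, Subtype.ext h.symm⟩

end Points

/-! ### Embeddings of a CM-field and complex conjugation -/

section Embeddings

variable (K : Type*) [Field K] [NumberField K]

variable {K} in
/-- Homomorphisms on the Galois closure of `K` are determined by their values on the conjugates
of `K`. -/
lemma galoisClosure_algHom_ext {M : Type*} [Field M] [Algebra ℚ M] {g h : GaloisClosure K →ₐ[ℚ] M}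
    (H : ∀ (φ : Emb K) (x : K), g (φ x) = h (φ x)) : g = h := by
  let E : IntermediateField ℚ (GaloisClosure K) :=
    (AlgHom.equalizer g h).toIntermediateField fun x hx => by
      rw [AlgHom.mem_equalizer] at hx ⊢
      rw [map_inv₀, map_inv₀, hx]
  -- The equalizer contains the generators of the Galois closure.
  have hle : GaloisClosure K ≤ E.map (GaloisClosure K).val := by
    refine normalClosure_le_iff.mpr fun f => ?_
    rintro _ ⟨x, rfl⟩
    exact ⟨(embEquiv K).symm f x, H ((embEquiv K).symm f) x, rfl⟩
  ext x
  obtain ⟨y, hy, hyx⟩ := hle x.2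
  obtain rfl : y = x := Subtype.ext hyx
  exact hy

variable {K} in
/-- The restriction of an embedding of `K` to the maximal totally real subfield. -/
def resEmb (ψ : Emb K) : Emb (maximalRealSubfield K) :=
  (embEquiv _).symm (((embEquiv K) ψ).comp (IsScalarTower.toAlgHom ℚ (maximalRealSubfield K) K))

variable {K} in
lemma coe_embEquiv (φ : Emb K) (x : K) : embEquiv K φ x = (φ x : GaloisClosure K) := rfl

variable {K} in
lemma coe_resEmb (ψ : Emb K) (x : maximalRealSubfield K) :
    ((resEmb ψ x : RealClosure K) : ℂ) = (ψ (x : K) : GaloisClosure K) := by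
  rw [← coe_embEquiv, ← coe_embEquiv, resEmb, Equiv.apply_symm_apply, AlgHom.comp_apply]
  rfl

variable {K} in
lemma resEmb_surjective : Function.Surjective (resEmb (K := K)) := by
  intro φ
  let : Algebra (maximalRealSubfield K) ℂ := (embEquiv _ φ).toRingHom.toAlgebra
  let g : K →ₐ[maximalRealSubfield K] ℂ := IsAlgClosed.lift
  refine ⟨(embEquiv K).symm g.toRingHom.toRatAlgHom, ?_⟩
  ext x
  exact g.commutes x

lemma realClosure_le : RealClosure K ≤ GaloisClosure K := by
  refine normalClosure_le_iff.mpr fun f => ?_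
  obtain ⟨ψ, hψ⟩ := resEmb_surjective ((embEquiv _).symm f)
  rintro _ ⟨x, rfl⟩
  have h : ((resEmb ψ x : RealClosure K) : ℂ) = f x := by rw [hψ]; rfl
  change f x ∈ _
  rw [← h, coe_resEmb]
  exact (ψ (x : K)).2

instance : Algebra (RealClosure K) (GaloisClosure K) :=
  (IntermediateField.inclusion (realClosure_le K)).toAlgebra

lemma coe_algebraMap (x : RealClosure K) :
    ((algebraMap (RealClosure K) (GaloisClosure K) x : GaloisClosure K) : ℂ) = x :=
  IntermediateField.coe_inclusion (realClosure_le K) x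

instance : IsScalarTower ℚ (RealClosure K) (GaloisClosure K) :=
  IsScalarTower.of_algebraMap_eq' (Subsingleton.elim _ _)

instance : FiniteDimensional (RealClosure K) (GaloisClosure K) :=
  FiniteDimensional.right ℚ _ _

instance : IsGalois ℚ (GaloisClosure K) where

instance : IsGalois (RealClosure K) (GaloisClosure K) :=
  IsGalois.tower_top_of_isGalois ℚ _ _

/-- The Galois closure of the totally real field `K₀` is contained in `ℝ`. -/
lemma conj_realClosure (x : RealClosure K) : conj (x : ℂ) = x := by
  have h : ((Complex.conjAe.restrictScalars ℚ : ℂ →ₐ[ℚ] ℂ)).comp (RealClosure K).val =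
      (RealClosure K).val := galoisClosure_algHom_ext fun φ y => by
    have := IsTotallyReal.complexEmbedding_isReal (embEquiv _ φ : maximalRealSubfield K →+* ℂ)
    exact RingHom.congr_fun this y
  exact DFunLike.congr_fun h x

variable {K}

lemma algebraMap_resEmb (ψ : Emb K) (x : maximalRealSubfield K) :
    algebraMap (RealClosure K) (GaloisClosure K) (resEmb ψ x) = ψ (x : K) :=
  Subtype.ext ((coe_algebraMap K _).trans (coe_resEmb ψ x))

variable {d : maximalRealSubfield K} {s : K} (hs : s ^ 2 = -(d : K))
  (hK : IntermediateField.adjoin (maximalRealSubfield K) {s} = ⊤)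

include hs in
lemma emb_sq (ψ : Emb K) : ψ s ^ 2 =
    algebraMap (RealClosure K) (GaloisClosure K) (-resEmb ψ d) := by
  rw [← map_pow, hs, map_neg, map_neg, algebraMap_resEmb]

include hK in
lemma emb_ext {ψ ψ' : Emb K} (h : resEmb ψ = resEmb ψ') (h' : ψ s = ψ' s) : ψ = ψ' := by
  let E : IntermediateField (maximalRealSubfield K) K :=
    (RingHom.eqLocusField (ψ : K →+* GaloisClosure K) ψ').toIntermediateField fun x => by
      change ψ (x : K) = ψ' (x : K)
      rw [← algebraMap_resEmb, ← algebraMap_resEmb, h]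
  have hE : (⊤ : IntermediateField (maximalRealSubfield K) K) ≤ E := by
    rw [← hK, IntermediateField.adjoin_simple_le_iff]
    exact h'
  ext x
  exact congrArg Subtype.val (hE (IntermediateField.mem_top (x := x)))

variable [IsCMField K]

lemma iota_emb (ψ : Emb K) (x : K) : iota K (ψ x) = ψ (IsCMField.complexConj K x) := by
  apply Subtype.ext
  rw [coe_iota]
  exact (IsCMField.complexEmbedding_complexConj K ((GaloisClosure K).val.comp ψ : K →+* ℂ) x).symm

/-- The Galois closure of a CM-field is a CM-field: complex conjugation commutes with all its
embeddings. -/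
lemma map_iota (g : GaloisClosure K →ₐ[ℚ] ℂ) (x : GaloisClosure K) :
    g (iota K x) = conj (g x) := by
  have h : g.comp (iota K : GaloisClosure K →ₐ[ℚ] GaloisClosure K) =
      ((Complex.conjAe.restrictScalars ℚ : ℂ →ₐ[ℚ] ℂ)).comp g :=
    galoisClosure_algHom_ext fun φ y => by
      change g (iota K (φ y)) = conj (g (φ y))
      rw [iota_emb]
      exact IsCMField.complexEmbedding_complexConj K (g.comp φ : K →+* ℂ) y
  exact DFunLike.congr_fun h x

lemma iota_mul_comm (σ : GalGroup K) : iota K * σ = σ * iota K := by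
  ext x
  refine Eq.trans ?_ (map_iota ((GaloisClosure K).val.comp
    (σ : GaloisClosure K →ₐ[ℚ] GaloisClosure K)) x).symm
  exact coe_iota K (σ x)

lemma resEmb_iota_smul (ψ : Emb K) : resEmb (iota K • ψ) = resEmb ψ := by
  ext x
  rw [coe_resEmb, coe_resEmb, smul_emb_apply, iota_emb, IsCMField.complexConj_apply_eq_self]

include hs hK in
/-- Complex conjugation on `K = K₀(s)` changes the sign of `s`. -/
lemma complexConj_generator : IsCMField.complexConj K s = -s := by
  have hsq : IsCMField.complexConj K s ^ 2 = s ^ 2 := by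
    rw [← map_pow, hs, map_neg, IsCMField.complexConj_apply_eq_self]
  refine (sq_eq_sq_iff_eq_or_eq_neg.mp hsq).resolve_left fun h => ?_
  refine IsCMField.complexConj_ne_one K (AlgEquiv.ext fun x => ?_)
  let E : IntermediateField (maximalRealSubfield K) K :=
    IntermediateField.fixedField (Subgroup.zpowers (IsCMField.complexConj K))
  have hmem (y : K) (hy : IsCMField.complexConj K y = y) : y ∈ E := by
    rw [IntermediateField.mem_fixedField_iff]
    intro f hf
    obtain ⟨n, rfl⟩ := hf
    exact MulAction.mem_fixedBy_zpow (g := IsCMField.complexConj K) hy n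
  have hE : (⊤ : IntermediateField (maximalRealSubfield K) K) ≤ E := by
    rw [← hK, IntermediateField.adjoin_simple_le_iff]
    exact hmem s h
  exact (IntermediateField.mem_fixedField_iff _ x).mp (hE (IntermediateField.mem_top (x := x))) _
    (Subgroup.mem_zpowers _)

include hs hK in
lemma generator_ne_zero : s ≠ 0 := by
  rintro rfl
  refine IsCMField.complexConj_ne_one K (AlgEquiv.ext fun x => ?_)
  have hx : x ∈ IntermediateField.adjoin (maximalRealSubfield K) {(0 : K)} :=
    hK ▸ IntermediateField.mem_top
  rw [IntermediateField.adjoin_zero, IntermediateField.mem_bot] at hx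
  obtain ⟨y, rfl⟩ := hx
  exact IsCMField.complexConj_apply_eq_self K y

include hs hK in
lemma iota_smul_generator (ψ : Emb K) : (iota K • ψ) s = -ψ s := by
  rw [smul_emb_apply, iota_emb, complexConj_generator hs hK, map_neg]

include hs hK in
lemma emb_generator_ne_zero (ψ : Emb K) : ψ s ≠ 0 :=
  (map_ne_zero ψ).mpr (generator_ne_zero hs hK)

include hs hK in
lemma eq_or_eq_iota_smul {ψ ψ' : Emb K} (h : resEmb ψ = resEmb ψ') :
    ψ = ψ' ∨ ψ = iota K • ψ' := by
  have h2 : ψ s ^ 2 = ψ' s ^ 2 := by rw [emb_sq hs, emb_sq hs, h]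
  rcases sq_eq_sq_iff_eq_or_eq_neg.mp h2 with h3 | h3
  · exact Or.inl (emb_ext hK h h3)
  · refine Or.inr (emb_ext hK (h.trans (resEmb_iota_smul ψ').symm) ?_)
    rw [h3, iota_smul_generator hs hK]

end Embeddings

/-! ### The Galois action on CM-types -/

section GaloisAction

variable {K : Type*} [Field K] [NumberField K]

lemma iota_smul_iota_smul (ψ : Emb K) : iota K • iota K • ψ = ψ :=
  AlgHom.ext fun x => iota_iota K (ψ x)

lemma mem_iota_smul_set (S : Set (Emb K)) (ψ : Emb K) : ψ ∈ iota K • S ↔ iota K • ψ ∈ S := by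
  constructor
  · rintro ⟨φ, hφ, rfl⟩
    change iota K • iota K • φ ∈ S
    rwa [iota_smul_iota_smul]
  · intro h
    exact ⟨_, h, iota_smul_iota_smul ψ⟩

lemma CMType.iota_smul_mem (Φ : CMType K) (ψ : Emb K) : iota K • ψ ∈ Φ.emb ↔ ψ ∉ Φ.emb := by
  rw [← mem_iota_smul_set]
  constructor
  · exact fun h h' => Set.disjoint_left.mp Φ.disjoint_iota h' h
  · exact fun h => (Φ.union_iota.ge (Set.mem_univ ψ)).resolve_left h

/-- A set that contains exactly one of `ψ` and `ιψ` for every embedding `ψ` is a CM-type. -/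
def CMType.ofIff (S : Set (Emb K)) (h : ∀ ψ, iota K • ψ ∈ S ↔ ψ ∉ S) : CMType K where
  emb := S
  disjoint_iota := Set.disjoint_left.mpr fun ψ hψ hψ' =>
    (h ψ).mp ((mem_iota_smul_set S ψ).mp hψ') hψ
  union_iota := Set.eq_univ_of_forall fun ψ => by
    by_cases hψ : ψ ∈ S
    · exact Or.inl hψ
    · exact Or.inr ((mem_iota_smul_set S ψ).mpr ((h ψ).mpr hψ))

lemma CMType.eq_of_subset {Φ Φ' : CMType K} (h : Φ.emb ⊆ Φ'.emb) : Φ = Φ' := by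
  refine CMType.ext (h.antisymm fun ψ hψ => ?_)
  by_contra hψ'
  exact (Φ'.iota_smul_mem ψ).mp (h ((Φ.iota_smul_mem ψ).mpr hψ')) hψ

/-- Every embedding of a reflex field in the Galois closure extends to an automorphism. -/
lemma exists_extend (Φ : CMType K) (g : reflexField Φ →ₐ[ℚ] GaloisClosure K) :
    ∃ τ : GalGroup K, ∀ x : reflexField Φ, τ x = g x :=
  ⟨AlgEquiv.ofBijective (g.liftNormal (GaloisClosure K)) (AlgHom.normal_bijective ℚ _ _ _),
    fun x => g.liftNormal_commutes (GaloisClosure K) x⟩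

variable [IsCMField K]

instance : SMul (GalGroup K) (CMType K) where
  smul σ Φ := CMType.ofIff (σ • Φ.emb) fun ψ => by
    rw [Set.mem_smul_set_iff_inv_smul_mem, Set.mem_smul_set_iff_inv_smul_mem, ← mul_smul,
      ← iota_mul_comm, mul_smul, Φ.iota_smul_mem]

lemma CMType.smul_emb (σ : GalGroup K) (Φ : CMType K) : (σ • Φ).emb = σ • Φ.emb := rfl

instance : MulAction (GalGroup K) (CMType K) where
  one_smul Φ := CMType.ext (one_smul _ Φ.emb)
  mul_smul σ τ Φ := CMType.ext (mul_smul σ τ Φ.emb)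

lemma CMType.isConj_iff {Φ Φ' : CMType K} : Φ.IsConj Φ' ↔ ∃ τ : GalGroup K, Φ' = τ • Φ :=
  exists_congr fun τ => (CMType.ext_iff (x := Φ') (y := τ • Φ)).symm

/-- Two automorphisms have the same effect on a CM-type if and only if they agree on its reflex
field. -/
lemma CMType.smul_eq_smul_iff (Φ : CMType K) (σ τ : GalGroup K) :
    σ • Φ = τ • Φ ↔ ∀ x : reflexField Φ, σ x = τ x := by
  have h1 : σ • Φ = τ • Φ ↔ τ⁻¹ * σ ∈ reflexGroup Φ := by
    rw [reflexGroup, MulAction.mem_stabilizer_iff, mul_smul, inv_smul_eq_iff, CMType.ext_iff]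
    rfl
  rw [h1, ← IntermediateField.fixingSubgroup_fixedField (reflexGroup Φ),
    IntermediateField.mem_fixingSubgroup_iff]
  refine Iff.trans ?_ Subtype.forall.symm
  refine forall₂_congr fun x hx => ?_
  rw [AlgEquiv.mul_apply, AlgEquiv.aut_inv, AlgEquiv.symm_apply_eq]

/-- The CM-type `τΦ`, for any extension `τ ∈ G` of an embedding of the reflex field of `Φ`. -/
def reflexPointType (Φ : CMType K) (g : reflexField Φ →ₐ[ℚ] GaloisClosure K) : CMType K :=
  (exists_extend Φ g).choose • Φ

lemma reflexPointType_eq (Φ : CMType K) (g : reflexField Φ →ₐ[ℚ] GaloisClosure K)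
    (τ : GalGroup K) (h : ∀ x : reflexField Φ, τ x = g x) : reflexPointType Φ g = τ • Φ :=
  (Φ.smul_eq_smul_iff _ τ).mpr fun x => by rw [h, (exists_extend Φ g).choose_spec]

/-- The embeddings of the reflex fields of a system of representatives correspond to the CM-types,
by the orbit-stabilizer theorem. -/
lemma reflexPointType_bijective {Λ : Set (CMType K)} (hΛ : IsRepresentatives Λ) :
    Function.Bijective fun p : Σ Φ : Λ, reflexField (Φ : CMType K) →ₐ[ℚ] GaloisClosure K =>
      reflexPointType (p.1 : CMType K) p.2 := by
  constructor
  · rintro ⟨⟨Φ, hΦ⟩, g⟩ ⟨⟨Φ', hΦ'⟩, g'⟩ h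
    obtain ⟨τ, hτ⟩ := exists_extend Φ g
    obtain ⟨τ', hτ'⟩ := exists_extend Φ' g'
    simp only [reflexPointType_eq _ g τ hτ, reflexPointType_eq _ g' τ' hτ'] at h
    obtain rfl : Φ = Φ' := (hΛ Φ).unique ⟨hΦ, CMType.isConj_iff.mpr ⟨1, (one_smul _ _).symm⟩⟩
      ⟨hΦ', CMType.isConj_iff.mpr ⟨τ'⁻¹ * τ, by rw [mul_smul, h, inv_smul_smul]⟩⟩
    congr 1
    refine AlgHom.ext fun x => ?_
    rw [← hτ, ← hτ', (Φ.smul_eq_smul_iff τ τ').mp h]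
  · intro Φ
    obtain ⟨Ψ, ⟨hΨ, hc⟩, -⟩ := hΛ Φ
    obtain ⟨τ, rfl⟩ := CMType.isConj_iff.mp hc
    refine ⟨⟨⟨τ • Φ, hΨ⟩, (τ⁻¹ : GalGroup K).toAlgHom.comp (reflexField (τ • Φ)).val⟩, ?_⟩
    refine (reflexPointType_eq _ _ τ⁻¹ fun x => rfl).trans (inv_smul_smul τ Φ)

lemma reflexPointType_comp (Φ : CMType K) (σ : GalGroup K)
    (g : reflexField Φ →ₐ[ℚ] GaloisClosure K) :
    reflexPointType Φ ((σ : GaloisClosure K →ₐ[ℚ] GaloisClosure K).comp g) =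
      σ • reflexPointType Φ g := by
  obtain ⟨τ, hτ⟩ := exists_extend Φ g
  rw [reflexPointType_eq Φ g τ hτ, ← mul_smul]
  exact reflexPointType_eq _ _ _ fun x => congrArg σ (hτ x)

end GaloisAction

/-! ### Scalar extensions of finite products of fields -/

section BaseChange

variable {k ι : Type*} {F L : Type*} {R : ι → Type*} [Finite ι] [Field k] [Field F] [Algebra k F]
  [∀ i, Field (R i)] [∀ i, Algebra k (R i)]

/-- The points of `F ⊗ ∏ Rᵢ` over `F` are the points of the factors `Rᵢ` over `k`. -/
def baseChangePiPointsEquiv [CommRing L] [IsDomain L] [Algebra k L] [Algebra F L]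
    [IsScalarTower k F L] :
    (Σ i, R i →ₐ[k] L) ≃ (F ⊗[k] (∀ i, R i) →ₐ[F] L) :=
  sigmaPointsEquiv.trans (AlgHom.liftEquiv k F (∀ i, R i) L)

lemma baseChangePiPointsEquiv_tmul [CommRing L] [IsDomain L] [Algebra k L] [Algebra F L]
    [IsScalarTower k F L] (p : Σ i, R i →ₐ[k] L) (a : F) (x : ∀ i, R i) :
    baseChangePiPointsEquiv p (a ⊗ₜ[k] x) = algebraMap F L a * p.2 (x p.1) :=
  Algebra.smul_def a _

lemma natCard_baseChangePiPoints [CommRing L] [IsDomain L] [Algebra k L] [Algebra F L]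
    [IsScalarTower k F L] [∀ i, FiniteDimensional k (R i)]
    (h : ∀ i, Nat.card (R i →ₐ[k] L) = Module.finrank k (R i)) :
    Nat.card (F ⊗[k] (∀ i, R i) →ₐ[F] L) = Module.finrank F (F ⊗[k] ∀ i, R i) := by
  have := Fintype.ofFinite ι
  rw [← Nat.card_congr baseChangePiPointsEquiv, Nat.card_sigma, Module.finrank_baseChange,
    Module.finrank_pi_fintype]
  exact Finset.sum_congr rfl fun i _ => h i

/-- The criterion `nonempty_algEquiv_of_equivariant` for the scalar extension of a product of
fields, stated through the points of the factors. -/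
theorem nonempty_baseChange_pi_algEquiv {V : Type*} [Field L] [Algebra k L] [Algebra F L]
    [IsScalarTower k F L] [∀ i, FiniteDimensional k (R i)] [FiniteDimensional F L] [IsGalois F L]
    [CommRing V] [Algebra F V] [FiniteDimensional F V]
    (hR : ∀ i, Nat.card (R i →ₐ[k] L) = Module.finrank k (R i))
    (hV : Nat.card (V →ₐ[F] L) = Module.finrank F V)
    (e : (Σ i, R i →ₐ[k] L) ≃ (V →ₐ[F] L))
    (he : ∀ (σ : L ≃ₐ[F] L) (i : ι) (g : R i →ₐ[k] L),
      e ⟨i, ((σ.restrictScalars k : L ≃ₐ[k] L) : L →ₐ[k] L).comp g⟩ =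
        (σ : L →ₐ[F] L).comp (e ⟨i, g⟩)) :
    Nonempty ((F ⊗[k] ∀ i, R i) ≃ₐ[F] V) := by
  refine nonempty_algEquiv_of_equivariant (L := L) (natCard_baseChangePiPoints hR) hV
    (baseChangePiPointsEquiv.symm.trans e) fun σ f => ?_
  obtain ⟨⟨i, g⟩, rfl⟩ := baseChangePiPointsEquiv.surjective f
  have h : (σ : L →ₐ[F] L).comp (baseChangePiPointsEquiv (F := F) ⟨i, g⟩) =
      baseChangePiPointsEquiv (F := F)
        ⟨i, ((σ.restrictScalars k : L ≃ₐ[k] L) : L →ₐ[k] L).comp g⟩ := by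
    refine (AlgHom.liftEquiv k F (∀ i, R i) L).symm.injective (AlgHom.ext fun x => ?_)
    rw [AlgHom.liftEquiv_symm_apply, AlgHom.liftEquiv_symm_apply, AlgHom.comp_apply,
      baseChangePiPointsEquiv_tmul, baseChangePiPointsEquiv_tmul, map_one, one_mul, one_mul]
    rfl
  rw [h, Equiv.trans_apply, Equiv.trans_apply, Equiv.symm_apply_apply, Equiv.symm_apply_apply, he]

end BaseChange

/-! ### The points of the two algebras -/

section Points

variable {K : Type*} [Field K] [NumberField K]

/-- The points of the Pfister algebra with values in a commutative `K₀ᶜ`-algebra `S`: families of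
square roots of the elements `-φ(d)` in `S`. -/
def pfisterPointsEquiv (d : maximalRealSubfield K) (S : Type*) [CommRing S]
    [Algebra (RealClosure K) S] : (PfisterAlgebra d →ₐ[RealClosure K] S) ≃
      ∀ φ : Emb (maximalRealSubfield K), {u : S // u ^ 2 = algebraMap (RealClosure K) S (-φ d)} :=
  letI : Fintype (Emb (maximalRealSubfield K)) := Fintype.ofFinite _
  piTensorPointsEquiv.trans (Equiv.piCongrRight fun φ => quadPointsEquiv (-φ d))

lemma finrank_pfisterAlgebra (d : maximalRealSubfield K) :
    Module.finrank (RealClosure K) (PfisterAlgebra d) =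
      2 ^ Nat.card (Emb (maximalRealSubfield K)) := by
  have := Fintype.ofFinite (Emb (maximalRealSubfield K))
  classical
  rw [Module.finrank_eq_card_basis (Basis.piTensorProduct
    fun φ : Emb (maximalRealSubfield K) => QuadraticAlgebra.basis (-φ d) 0)]
  simp [Nat.card_eq_fintype_card]

/-- The automorphism over `ℚ` underlying an automorphism over `K₀ᶜ`. -/
abbrev toGalGroup (σ : GaloisClosure K ≃ₐ[RealClosure K] GaloisClosure K) : GalGroup K :=
  σ.restrictScalars ℚ

lemma resEmb_toGalGroup_smul (σ : GaloisClosure K ≃ₐ[RealClosure K] GaloisClosure K)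
    (ψ : Emb K) : resEmb (toGalGroup σ • ψ) = resEmb ψ := by
  ext x
  have h : toGalGroup σ (algebraMap (RealClosure K) (GaloisClosure K) (resEmb ψ x)) =
      algebraMap (RealClosure K) (GaloisClosure K) (resEmb ψ x) := σ.commutes _
  rw [coe_resEmb, smul_emb_apply, ← algebraMap_resEmb, h, coe_algebraMap]

lemma natCard_reflexFieldPoints (Φ : CMType K) :
    Nat.card (reflexField Φ →ₐ[ℚ] GaloisClosure K) = Module.finrank ℚ (reflexField Φ) := by
  refine AlgHom.natCard_of_splits _ _ _ fun x => ?_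
  have h := Normal.splits (inferInstance : Normal ℚ (GaloisClosure K)) (x : GaloisClosure K)
  rwa [← IntermediateField.minpoly_eq] at h

variable [IsCMField K] {d : maximalRealSubfield K} {s : K} (hs : s ^ 2 = -(d : K))
  (hK : IntermediateField.adjoin (maximalRealSubfield K) {s} = ⊤)

include hs hK in
/-- Both square roots of every `-φ(d)` lie in the Galois closure of `K`, so that the Pfister
algebra has as many points there as its dimension. -/
lemma card_pfisterPoints : Nat.card (PfisterAlgebra d →ₐ[RealClosure K] GaloisClosure K) =
    Module.finrank (RealClosure K) (PfisterAlgebra d) := by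
  have := Fintype.ofFinite (Emb (maximalRealSubfield K))
  rw [finrank_pfisterAlgebra, Nat.card_congr (pfisterPointsEquiv d (GaloisClosure K)), Nat.card_pi,
    Finset.prod_congr rfl fun φ _ => ?_, Finset.prod_const, Finset.card_univ,
    Nat.card_eq_fintype_card]
  obtain ⟨ψ, rfl⟩ := resEmb_surjective φ
  rw [← Nat.card_congr (sqrtEquivBool (ψ s) (emb_generator_ne_zero hs hK ψ) (emb_sq hs ψ))]
  simp

/-- The CM-type of a point of the Pfister algebra: the embeddings `ψ` of `K = K₀(s)` that send `s`
to the square root of `-φ(d)` given by the point, where `φ` is the restriction of `ψ`. -/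
def pfisterPointType (f : PfisterAlgebra d →ₐ[RealClosure K] GaloisClosure K) : CMType K :=
  CMType.ofIff {ψ | ψ s = pfisterPointsEquiv d _ f (resEmb ψ)} fun ψ => by
    have hsq : ψ s ^ 2 = (pfisterPointsEquiv d _ f (resEmb ψ) : GaloisClosure K) ^ 2 := by
      rw [emb_sq hs, (pfisterPointsEquiv d _ f (resEmb ψ)).2]
    have h0 := emb_generator_ne_zero hs hK ψ
    rw [Set.mem_ofPred_eq, Set.mem_ofPred_eq, resEmb_iota_smul, iota_smul_generator hs hK]
    constructor
    · intro h h'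
      rw [← h'] at h
      exact h0 (self_eq_neg.mp h.symm)
    · intro h
      exact neg_eq_iff_eq_neg.mpr ((sq_eq_sq_iff_eq_or_eq_neg.mp hsq).resolve_left h)

lemma mem_pfisterPointType (f : PfisterAlgebra d →ₐ[RealClosure K] GaloisClosure K) (ψ : Emb K) :
    ψ ∈ (pfisterPointType hs hK f).emb ↔ ψ s = pfisterPointsEquiv d _ f (resEmb ψ) := Iff.rfl

lemma CMType.exists_mem_resEmb_eq (Φ : CMType K) (φ : Emb (maximalRealSubfield K)) :
    ∃ ψ ∈ Φ.emb, resEmb ψ = φ := by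
  obtain ⟨ψ, rfl⟩ := resEmb_surjective φ
  by_cases h : ψ ∈ Φ.emb
  · exact ⟨ψ, h, rfl⟩
  · exact ⟨_, (Φ.iota_smul_mem ψ).mpr h, resEmb_iota_smul ψ⟩

lemma pfisterPointType_bijective : Function.Bijective (pfisterPointType hs hK) := by
  constructor
  · intro f f' h
    refine (pfisterPointsEquiv d _).injective (funext fun φ => Subtype.ext ?_)
    obtain ⟨ψ, hψ, rfl⟩ := (pfisterPointType hs hK f).exists_mem_resEmb_eq φ
    have hψ' := hψ
    rw [h] at hψ'
    exact ((mem_pfisterPointType hs hK f ψ).mp hψ).symm.trans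
      ((mem_pfisterPointType hs hK f' ψ).mp hψ')
  · -- The point of a CM-type `Φ` sends `√-φ(d)` to `ψ(s)`, for the extension `ψ ∈ Φ` of `φ`.
    intro Φ
    choose ψ hψ hres using Φ.exists_mem_resEmb_eq
    let u : ∀ φ : Emb (maximalRealSubfield K), {u : GaloisClosure K //
        u ^ 2 = algebraMap (RealClosure K) (GaloisClosure K) (-φ d)} :=
      fun φ => ⟨ψ φ s, by rw [emb_sq hs, hres]⟩
    refine ⟨(pfisterPointsEquiv d _).symm u, (CMType.eq_of_subset fun χ hχ => ?_).symm⟩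
    rw [mem_pfisterPointType, Equiv.apply_symm_apply]
    change χ s = ψ (resEmb χ) s
    rcases eq_or_eq_iota_smul hs hK (hres (resEmb χ)) with h | h
    · rw [h]
    · exact ((Φ.iota_smul_mem χ).mp (h ▸ hψ (resEmb χ)) hχ).elim

lemma pfisterPointType_comp (σ : GaloisClosure K ≃ₐ[RealClosure K] GaloisClosure K)
    (f : PfisterAlgebra d →ₐ[RealClosure K] GaloisClosure K) :
    pfisterPointType hs hK ((σ : GaloisClosure K →ₐ[RealClosure K] GaloisClosure K).comp f) =
      toGalGroup σ • pfisterPointType hs hK f := by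
  refine (CMType.eq_of_subset ?_).symm
  rintro _ ⟨ψ, hψ, rfl⟩
  change toGalGroup σ • ψ ∈ _
  rw [mem_pfisterPointType, resEmb_toGalGroup_smul, smul_emb_apply,
    (mem_pfisterPointType hs hK f ψ).mp hψ]
  rfl

include hs hK in
/-- Both algebras have the CM-types of `K` as their points, with the same Galois action. -/
theorem nonempty_algEquiv_pfisterAlgebra {Λ : Set (CMType K)} (hΛ : IsRepresentatives Λ) :
    Nonempty ((RealClosure K ⊗[ℚ] ReflexSum Λ) ≃ₐ[RealClosure K] PfisterAlgebra d) := by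
  let e₁ := Equiv.ofBijective _ (reflexPointType_bijective hΛ)
  let e₂ := Equiv.ofBijective _ (pfisterPointType_bijective hs hK)
  refine nonempty_baseChange_pi_algEquiv (L := GaloisClosure K)
    (fun Φ : Λ => natCard_reflexFieldPoints Φ.1) (card_pfisterPoints hs hK)
    (e₁.trans e₂.symm) fun σ Φ g => ?_
  rw [Equiv.trans_apply, Equiv.trans_apply, Equiv.symm_apply_eq]
  refine Eq.trans ?_ (pfisterPointType_comp hs hK σ _).symm
  refine (reflexPointType_comp Φ.1 (toGalGroup σ) g).trans ?_
  exact congrArg (toGalGroup σ • ·) (e₂.apply_symm_apply (e₁ ⟨Φ, g⟩)).symm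

end Points

/-! ### The sum of the squared absolute values over the complex points -/

section PointForm

/-- The sum of `f(a) conj(f(b))` over the complex points `f` of an algebra `A` over a field `F`. It
is meaningful if `A` has finitely many complex points, and `finsum` may be zero by convention
otherwise. -/
def pointForm (F : Type*) {A : Type*} [Field F] [Algebra F ℂ] [CommRing A] [Algebra F A]
    (a b : A) : ℂ :=
  ∑ᶠ f : A →ₐ[F] ℂ, f a * conj (f b)

lemma pointForm_eq_sum (F : Type*) {A : Type*} [Field F] [Algebra F ℂ] [CommRing A] [Algebra F A]
    [Fintype (A →ₐ[F] ℂ)] (a b : A) :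
    pointForm F a b = ∑ f : A →ₐ[F] ℂ, f a * conj (f b) :=
  finsum_eq_sum_of_fintype _

variable {F : Type*} [Field F] [Algebra F ℂ]

lemma pointForm_algEquiv {A B : Type*} [CommRing A] [Algebra F A] [CommRing B] [Algebra F B]
    (e : A ≃ₐ[F] B) (a b : A) : pointForm F (e a) (e b) = pointForm F a b :=
  finsum_comp_equiv (e.symm.arrowCongr (AlgEquiv.refl (R := F) (A₁ := ℂ)))
    (f := fun f : A →ₐ[F] ℂ => f a * conj (f b))

lemma pointForm_add_left {A : Type*} [CommRing A] [Algebra F A] [Finite (A →ₐ[F] ℂ)]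
    (a a' b : A) : pointForm F (a + a') b = pointForm F a b + pointForm F a' b := by
  have := Fintype.ofFinite (A →ₐ[F] ℂ)
  simp only [pointForm_eq_sum, map_add, add_mul, Finset.sum_add_distrib]

lemma pointForm_add_right {A : Type*} [CommRing A] [Algebra F A] [Finite (A →ₐ[F] ℂ)]
    (a b b' : A) : pointForm F a (b + b') = pointForm F a b + pointForm F a b' := by
  have := Fintype.ofFinite (A →ₐ[F] ℂ)
  simp only [pointForm_eq_sum, map_add, mul_add, Finset.sum_add_distrib]

@[simp]
lemma pointForm_zero_left {A : Type*} [CommRing A] [Algebra F A] (b : A) :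
    pointForm F 0 b = 0 := by
  simp [pointForm]

@[simp]
lemma pointForm_zero_right {A : Type*} [CommRing A] [Algebra F A] (a : A) :
    pointForm F a 0 = 0 := by
  simp [pointForm]

lemma pointForm_smul_left {A : Type*} [CommRing A] [Algebra F A] [Finite (A →ₐ[F] ℂ)]
    (c : F) (a b : A) : pointForm F (c • a) b = algebraMap F ℂ c * pointForm F a b := by
  have := Fintype.ofFinite (A →ₐ[F] ℂ)
  simp only [pointForm_eq_sum, map_smul, Finset.mul_sum]
  refine Finset.sum_congr rfl fun f _ => ?_
  rw [Algebra.smul_def, mul_assoc]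

section

variable (hF : ∀ a : F, conj (algebraMap F ℂ a) = algebraMap F ℂ a)

include hF

lemma pointForm_smul_right {A : Type*} [CommRing A] [Algebra F A] [Finite (A →ₐ[F] ℂ)]
    (c : F) (a b : A) : pointForm F a (c • b) = algebraMap F ℂ c * pointForm F a b := by
  have := Fintype.ofFinite (A →ₐ[F] ℂ)
  simp only [pointForm_eq_sum, map_smul, Finset.mul_sum]
  refine Finset.sum_congr rfl fun f _ => ?_
  rw [Algebra.smul_def, map_mul, hF, mul_left_comm]

lemma pointForm_tmul [CharZero F] {X : Type*} [CommRing X] [Algebra ℚ X] [Finite (X →ₐ[ℚ] ℂ)]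
    (a b : F) (x y : X) :
    pointForm F (a ⊗ₜ[ℚ] x) (b ⊗ₜ[ℚ] y) = algebraMap F ℂ (a * b) * pointForm ℚ x y := by
  have := Fintype.ofFinite (X →ₐ[ℚ] ℂ)
  rw [pointForm_eq_sum ℚ, pointForm, ← finsum_comp_equiv (AlgHom.liftEquiv ℚ F X ℂ),
    finsum_eq_sum_of_fintype, Finset.mul_sum]
  refine Finset.sum_congr rfl fun f _ => ?_
  rw [AlgHom.liftEquiv_tmul, AlgHom.liftEquiv_tmul, Algebra.smul_def, Algebra.smul_def, map_mul,
    map_mul, hF]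
  ring

/-- If a rational quadratic form on `X` is the sum of `|f(x)|²` over the complex points `f` of `X`,
its extension of scalars to a real field `F` is the same sum over the complex points of `F ⊗ X`. -/
lemma algebraMap_baseChange_eq_pointForm [CharZero F] {X : Type*} [CommRing X] [Algebra ℚ X]
    [Finite (X →ₐ[ℚ] ℂ)] (Q : QuadraticForm ℚ X)
    (hQ : ∀ x, algebraMap ℚ ℂ (Q x) = pointForm ℚ x x) (w : F ⊗[ℚ] X) :
    algebraMap F ℂ (QuadraticForm.baseChange F Q w) = pointForm F w w := by
  have : Finite (F ⊗[ℚ] X →ₐ[F] ℂ) := Finite.of_equiv _ (AlgHom.liftEquiv ℚ F X ℂ)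
  let : Invertible (2 : F) := invertibleOfNonzero two_ne_zero
  -- A quadratic form is not determined by its values on pure tensors, its polar form is.
  have hpolar (w w' : F ⊗[ℚ] X) :
      algebraMap F ℂ (LinearMap.BilinForm.baseChange F Q.polarBilin w w') =
        pointForm F w w' + pointForm F w' w := by
    induction w using TensorProduct.induction_on with
    | zero => simp
    | add w₁ w₂ h₁ h₂ =>
      rw [map_add, LinearMap.add_apply, map_add, h₁, h₂, pointForm_add_left, pointForm_add_right]
      ring
    | tmul a x =>
      induction w' using TensorProduct.induction_on with
      | zero => simp
      | add w₁ w₂ h₁ h₂ =>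
        rw [map_add, map_add, h₁, h₂, pointForm_add_left, pointForm_add_right]
        ring
      | tmul b y =>
        have hxy : algebraMap ℚ ℂ (Q.polarBilin x y) = pointForm ℚ x y + pointForm ℚ y x := by
          rw [QuadraticMap.polarBilin_apply_apply, QuadraticMap.polar, map_sub, map_sub, hQ, hQ, hQ,
            pointForm_add_left, pointForm_add_right, pointForm_add_right]
          ring
        rw [LinearMap.BilinForm.baseChange_tmul, pointForm_tmul hF, pointForm_tmul hF,
          Algebra.smul_def, map_mul, ← IsScalarTower.algebraMap_apply, hxy, mul_comm b a]
        ring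
  have h := hpolar w w
  rw [← QuadraticForm.polarBilin_baseChange, QuadraticMap.polarBilin_apply_apply,
    QuadraticMap.polar_self, two_nsmul, map_add] at h
  linear_combination h / 2

/-- The complex points `f` of `F(√-a)` satisfy `∑ f(x) conj(f(y)) = 2 B(x, y)` for the bilinear form
`B` of `⟨1, a⟩`, provided that the square roots of `-a` are purely imaginary. -/
lemma pointForm_quadraticAlgebra [Invertible (2 : F)] {a : F} (ha : a ≠ 0)
    (hroot : ∀ u : ℂ, u ^ 2 = algebraMap F ℂ (-a) → conj u = -u)
    (x y : QuadraticAlgebra F (-a) 0) :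
    pointForm F x y = 2 * algebraMap F ℂ (QuadraticMap.associated (binaryForm a) x y) := by
  obtain ⟨z, hz⟩ := IsAlgClosed.exists_pow_nat_eq (algebraMap F ℂ (-a)) two_pos
  have hz0 : z ≠ 0 := by
    rintro rfl
    simp [ha] at hz
  have h2 : 2 * algebraMap F ℂ (QuadraticMap.associated (binaryForm a) x y) =
      2 * (algebraMap F ℂ x.re * algebraMap F ℂ y.re - z ^ 2 *
        (algebraMap F ℂ x.im * algebraMap F ℂ y.im)) := by
    have h := QuadraticMap.two_nsmul_associated F (binaryForm a)
    have h' := congrArg (algebraMap F ℂ) (LinearMap.congr_fun₂ h x y)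
    rw [LinearMap.smul_apply, LinearMap.smul_apply, two_nsmul, map_add] at h'
    rw [two_mul, hz]
    refine h'.trans ?_
    rw [QuadraticMap.polarBilin_apply_apply, QuadraticMap.polar, binaryForm_apply,
      binaryForm_apply, binaryForm_apply]
    simp only [QuadraticAlgebra.re_add, QuadraticAlgebra.im_add, map_sub, map_add, map_mul, map_pow,
      map_neg]
    ring
  rw [h2, pointForm, ← finsum_comp_equiv (quadPointsEquiv (-a)).symm,
    ← finsum_comp_equiv (sqrtEquivBool z hz0 hz), finsum_eq_sum_of_fintype, Fintype.sum_bool,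
    quadPointsEquiv_symm_apply, quadPointsEquiv_symm_apply, quadPointsEquiv_symm_apply,
    quadPointsEquiv_symm_apply]
  change (_ + _ * z) * conj (_ + _ * z) + (_ + _ * -z) * conj (_ + _ * -z) = _
  simp only [map_add, map_mul, map_neg, hF, hroot z hz]
  ring

/-- The sum over the complex points of a tensor product of quadratic algebras is the product of the
sums over the complex points of the factors. -/
lemma pointForm_eq_quadTensor [Invertible (2 : F)] {ι : Type*} [Fintype ι] {a : ι → F}
    (ha : ∀ i, a i ≠ 0) (hroot : ∀ i, ∀ u : ℂ, u ^ 2 = algebraMap F ℂ (-a i) → conj u = -u)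
    (v : ⨂[F] i, QuadraticAlgebra F (-a i) 0) :
    pointForm F v v =
      2 ^ Fintype.card ι * algebraMap F ℂ (quadTensor (fun i => binaryForm (a i)) v) := by
  classical
  have (i : ι) := Fintype.ofFinite (QuadraticAlgebra F (-a i) 0 →ₐ[F] ℂ)
  have hfin : Finite ((⨂[F] i, QuadraticAlgebra F (-a i) 0) →ₐ[F] ℂ) :=
    Finite.of_equiv _ piTensorPointsEquiv.symm
  have hB (v w : ⨂[F] i, QuadraticAlgebra F (-a i) 0) : pointForm F v w = 2 ^ Fintype.card ι *
      algebraMap F ℂ (bilinTensor (fun i => QuadraticMap.associated (binaryForm (a i))) v w) := by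
    induction v using PiTensorProduct.induction_on with
    | add v₁ v₂ h₁ h₂ => rw [pointForm_add_left, h₁, h₂, map_add, LinearMap.add_apply, map_add,
        mul_add]
    | smul_tprod r x =>
      induction w using PiTensorProduct.induction_on with
      | add w₁ w₂ h₁ h₂ => rw [pointForm_add_right, h₁, h₂, map_add, map_add, mul_add]
      | smul_tprod t y =>
        have hxy : pointForm F (PiTensorProduct.tprod F x) (PiTensorProduct.tprod F y) =
            ∏ i, pointForm F (x i) (y i) := by
          rw [Finset.prod_congr rfl fun i _ => pointForm_eq_sum F (x i) (y i), pointForm,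
            ← finsum_comp_equiv piTensorPointsEquiv.symm, finsum_eq_sum_of_fintype,
            Finset.prod_univ_sum, Fintype.piFinset_univ]
          refine Finset.sum_congr rfl fun g _ => ?_
          rw [piTensorPointsEquiv_symm_tprod, piTensorPointsEquiv_symm_tprod, map_prod,
            Finset.prod_mul_distrib]
        rw [pointForm_smul_left, pointForm_smul_right hF, hxy, map_smul,
          LinearMap.map_smul₂, bilinTensor_tprod,
          Finset.prod_congr rfl fun i _ => pointForm_quadraticAlgebra hF (ha i) (hroot i) _ _,
          Finset.prod_mul_distrib, Finset.prod_const, Finset.card_univ, smul_eq_mul, smul_eq_mul,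
          map_mul, map_mul, map_prod]
        ring
  exact hB v v

end

end PointForm

/-! ### The Pfister form and the reflex trace form -/

section Forms

variable {K : Type*} [Field K] [NumberField K]

lemma natCard_emb (F : Type*) [Field F] [NumberField F] :
    Nat.card (Emb F) = Module.finrank ℚ F := by
  rw [Nat.card_congr (embEquiv F)]
  exact AlgHom.natCard_of_splits _ _ _ fun _ => IsAlgClosed.splits _

variable [IsCMField K]

/-- Embeddings of a reflex field commute with complex conjugation, because they extend to the Galois
closure of the CM-field. -/
lemma map_reflexConj (Φ : CMType K) (g : reflexField Φ →ₐ[ℚ] ℂ) (x : reflexField Φ) :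
    g (reflexConj Φ x) = conj (g x) := by
  obtain ⟨h, rfl⟩ := IntermediateField.exists_algHom_of_splits (E := GaloisClosure K)
    (fun x => ⟨Algebra.IsIntegral.isIntegral x, IsAlgClosed.splits _⟩) g
  exact map_iota h x

lemma algebraMap_traceForm (Φ : CMType K) (x : reflexField Φ) :
    algebraMap ℚ ℂ (traceForm Φ x) = pointForm ℚ x x := by
  rw [traceForm_apply, pointForm_eq_sum]
  refine (trace_eq_sum_embeddings ℂ).trans ?_
  refine (Fintype.sum_equiv (Equiv.refl _) _ _ fun g => ?_)
  rw [map_mul, map_reflexConj, mul_comm]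
  rfl

lemma algebraMap_reflexForm (Λ : Set (CMType K)) (x : ReflexSum Λ) :
    algebraMap ℚ ℂ (reflexForm Λ x) = pointForm ℚ x x := by
  let : Fintype Λ := Fintype.ofFinite Λ
  rw [reflexForm, QuadraticMap.pi_apply, map_sum, pointForm, ← finsum_comp_equiv sigmaPointsEquiv,
    finsum_eq_sum_of_fintype, Fintype.sum_sigma]
  refine Finset.sum_congr rfl fun Φ _ => ?_
  rw [algebraMap_traceForm, pointForm_eq_sum]
  rfl

variable {d : maximalRealSubfield K} {s : K} (hs : s ^ 2 = -(d : K))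
  (hK : IntermediateField.adjoin (maximalRealSubfield K) {s} = ⊤)

include hs hK in
/-- The square roots of the conjugates of `-d` are purely imaginary. -/
lemma conj_sqrt (φ : Emb (maximalRealSubfield K)) (u : ℂ)
    (hu : u ^ 2 = algebraMap (RealClosure K) ℂ (-φ d)) : conj u = -u := by
  obtain ⟨ψ, rfl⟩ := resEmb_surjective φ
  have hψ : conj (ψ s : ℂ) = -(ψ s : ℂ) := by
    rw [← coe_iota, ← smul_emb_apply, iota_smul_generator hs hK]
    rfl
  have hsq : u ^ 2 = (ψ s : ℂ) ^ 2 :=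
    hu.trans ((coe_algebraMap K _).symm.trans (congrArg Subtype.val (emb_sq hs ψ)).symm)
  rcases sq_eq_sq_iff_eq_or_eq_neg.mp hsq with rfl | rfl
  · exact hψ
  · rw [map_neg, hψ]

include hs hK in
lemma emb_radicand_ne_zero (φ : Emb (maximalRealSubfield K)) : φ d ≠ 0 := by
  refine (map_ne_zero φ).mpr ?_
  rintro rfl
  exact generator_ne_zero hs hK (pow_eq_zero_iff two_ne_zero |>.mp (by simpa using hs))

include hs hK in
/-- On the Pfister algebra, the sum of `|f(v)|²` over the complex points `f` is `2^N q(v)`. -/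
lemma coe_pfisterForm (v : PfisterAlgebra d) :
    pointForm (RealClosure K) v v =
      2 ^ Module.finrank ℚ (maximalRealSubfield K) * (pfisterForm d v : RealClosure K) := by
  let : Fintype (Emb (maximalRealSubfield K)) := Fintype.ofFinite _
  let : Invertible (2 : RealClosure K) := invertibleOfNonzero two_ne_zero
  rw [← natCard_emb, Nat.card_eq_fintype_card]
  exact pointForm_eq_quadTensor (conj_realClosure K) (emb_radicand_ne_zero hs hK)
    (conj_sqrt hs hK) v

lemma coe_baseChange_reflexForm (Λ : Set (CMType K)) (w : RealClosure K ⊗[ℚ] ReflexSum Λ) :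
    (QuadraticForm.baseChange (RealClosure K) (reflexForm Λ) w : RealClosure K) =
      pointForm (RealClosure K) w w :=
  algebraMap_baseChange_eq_pointForm (conj_realClosure K) (reflexForm Λ)
    (algebraMap_reflexForm Λ) w

end Forms

end ReflexPfister

end

open ReflexPfister
theorem theorem3 (K : Type*) [Field K] [NumberField K] [IsCMField K]
    (d : maximalRealSubfield K) (hd : IsTotallyPositive d)
    (s : K) (hs : s ^ 2 = -(d : K))
    (hK : IntermediateField.adjoin (maximalRealSubfield K) {s} = ⊤)
    (Λ : Set (CMType K)) (hΛ : IsRepresentatives Λ) :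
    Nonempty ((RealClosure K ⊗[ℚ] ReflexSum Λ) ≃ₐ[RealClosure K] PfisterAlgebra d) ∧
    ∀ (φΛ : (RealClosure K ⊗[ℚ] ReflexSum Λ) ≃ₐ[RealClosure K] PfisterAlgebra d)
      (w : RealClosure K ⊗[ℚ] ReflexSum Λ),
      pfisterForm d (φΛ w) =
        ((2 : RealClosure K) ^ Module.finrank ℚ (maximalRealSubfield K))⁻¹ *
          QuadraticForm.baseChange (RealClosure K) (reflexForm Λ) w := by
  refine ⟨nonempty_algEquiv_pfisterAlgebra hs hK hΛ, fun φΛ w => ?_⟩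
  rw [eq_inv_mul_iff_mul_eq₀ (pow_ne_zero _ two_ne_zero)]
  apply Subtype.ext
  rw [coe_baseChange_reflexForm, ← pointForm_algEquiv φΛ, coe_pfisterForm hs hK]
  rfl
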